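/- Let $A$ denote the Glaisher–Kinkelin constant, $A=\lim_{n\to\infty}\dfrac{1^1 2^2\cdots n^n}{n^{\frac{n^2+n}{2}+\frac1{12}}e^{-\frac{n^2}{4}}}=1.28242712\ldots$; this limit exists and is positive. Let $B>1$ be an integer. For an integer $k\ge 1$ let $L_B(k)=\lfloor\log_B(Bk)\rfloor$ be the number of digits of $k$ in base $B$, and let $L_B(0)=0$. Let $$P_B(x)=(Bx+1)(Bx+2)\cdots(Bx+B-1)\sum_{m=1}^{B-1}\frac{m(B-m)}{Bx+m},$$ and define the sequence $(b_k)_{k\ge 0}$ by $b_0=0$ and $b_k=b_{\lfloor k/B\rfloor}+(-1)^{k-1}(6k+3)$ for $k\ge 1$. Then $$\log A=\frac{13}{48}-\frac{1}{36}\sum_{k=1}^{\infty}\Bigl(7L_B(k)-7L_B\bigl(\lfloor k/2\rfloor\bigr)+b_k\Bigr)\frac{P_B(k)}{Bk(Bk+1)\cdots(Bk+B)},$$ where the series converges absolutely. -/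

import Mathlib

open Filter Topology

noncomputable section

/-- The sequence `1 ^ 1 * 2 ^ 2 * ⋯ * n ^ n / (n ^ ((n ^ 2 + n) / 2 + 1 / 12) * e ^ (-n ^ 2 / 4))`
whose limit is the Glaisher-Kinkelin constant. -/
def glaisherSeq (n : ℕ) : ℝ :=
  (∏ j ∈ Finset.Icc 1 n, (j : ℝ) ^ j) /
    ((n : ℝ) ^ (((n : ℝ) ^ 2 + n) / 2 + 1 / 12) * Real.exp (-((n : ℝ) ^ 2 / 4)))

/-- The Glaisher-Kinkelin constant `A = 1.28242712…`, the limit of `glaisherSeq`. -/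
def glaisherConst : ℝ := limUnder atTop glaisherSeq

/-- `L_B(k) = ⌊log_B (B k)⌋`, the number of digits of `k` in base `B`; `L_B(0) = 0`. -/
def baseLength (B k : ℕ) : ℕ := (Nat.digits B k).length

theorem baseLength_zero (B : ℕ) : baseLength B 0 = 0 := by
  simp [baseLength]

theorem baseLength_eq_floor_logb {B k : ℕ} (hB : 1 < B) (hk : 1 ≤ k) :
    baseLength B k = ⌊Real.logb B (B * k)⌋₊ := by
  have h := Real.floor_logb_natCast (b := B) (r := ((B * k : ℕ) : ℝ)) (by positivity)
  rw [Int.log_natCast] at h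
  have h2 : ⌊Real.logb (B : ℝ) (B * k)⌋ = ((Nat.log B (B * k) : ℕ) : ℤ) := by
    rw [← h]; push_cast; rfl
  rw [baseLength, Nat.length_digits B k hB (by omega), ← Int.floor_toNat, h2, Int.toNat_natCast,
    mul_comm B k, Nat.log_mul_base hB (by omega)]

/-- `P_B(x) = (Bx + 1)(Bx + 2) ⋯ (Bx + B - 1) ∑_{m = 1}^{B - 1} m (B - m) / (Bx + m)`
(used at positive integers `x` only, where no denominator vanishes). -/
def addisonP (B : ℕ) (x : ℝ) : ℝ :=
  (∏ j ∈ Finset.Ico 1 B, ((B : ℝ) * x + j)) *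
    ∑ m ∈ Finset.Ico 1 B, (m : ℝ) * ((B : ℝ) - m) / ((B : ℝ) * x + m)

/-- The sequence `b_0 = 0`, `b_k = b_{⌊k / B⌋} + (-1) ^ (k - 1) (6 k + 3)` for `k ≥ 1`, in a base
`B > 1` (for `B ≤ 1`, where the recursion does not define a sequence, it is set to zero). -/
def glaisherCoeff (B : ℕ) : ℕ → ℤ
  | 0 => 0
  | k + 1 =>
    if _h : 1 < B then
      glaisherCoeff B ((k + 1) / B) + (-1) ^ k * (6 * ((k : ℤ) + 1) + 3)
    else 0
decreasing_by exact Nat.div_lt_self (Nat.succ_pos k) _h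

theorem glaisherCoeff_zero (B : ℕ) : glaisherCoeff B 0 = 0 := by
  rw [glaisherCoeff]

theorem glaisherCoeff_of_pos {B k : ℕ} (hB : 1 < B) (hk : 1 ≤ k) :
    glaisherCoeff B k = glaisherCoeff B (k / B) + (-1) ^ (k - 1) * (6 * (k : ℤ) + 3) := by
  obtain ⟨n, rfl⟩ : ∃ n, k = n + 1 := ⟨k - 1, by omega⟩
  rw [glaisherCoeff]
  simp [hB]

/-- The `k`-th term
`(7 L_B(k) - 7 L_B(⌊k / 2⌋) + b_k) P_B(k) / (Bk (Bk + 1) ⋯ (Bk + B))` of the series, `k ≥ 1`. -/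
def glaisherTerm (B k : ℕ) : ℝ :=
  (7 * (baseLength B k : ℝ) - 7 * (baseLength B (k / 2) : ℝ) + (glaisherCoeff B k : ℝ)) *
    (addisonP B k / ∏ j ∈ Finset.range (B + 1), ((B : ℝ) * k + j))

end

/-! Write `ε(k)` for `trapezoidError k` and `c(k)` for `seriesCoeff B k`. The rational factor of the
series is `ε(k) - ∑_{j<B} ε(Bk+j)` (`addisonP_div_eq`). As `n = Bk+j` runs over base-`B` blocks, the
series becomes `∑ (c(n) - c(⌊n/B⌋)) ε(n)` (`hasSum_mul_sum_block`), absolutely convergent since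
`c(n) = O(n)` and `ε(n) = O(n⁻³)`. By `seriesCoeff_sub_succ` this is `7 ε(1) + ∑ (-1)^(n-1) (6n+3)
ε(n)`, free of `B`. Its even partial sums are explicit in harmonic numbers and hyperfactorials, with
limit `7 log 2 + 9/2 - 36 log A`; since `ε(1) = 3/4 - log 2`, the total is `39/4 - 36 log A`. -/

/-! ### Trapezoidal errors -/

/-- The error of the trapezoidal rule for `∫ x in k..k+1, 1 / x`. -/
noncomputable def trapezoidError (k : ℕ) : ℝ :=
  (1 / (k : ℝ) + 1 / ((k : ℝ) + 1)) / 2 - (Real.log ((k : ℝ) + 1) - Real.log k)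

/-- The difference is `2 artanh t`: keep two terms of the series and compare the tail with a
geometric one. -/
theorem log_succ_sub_log_bounds {n : ℕ} (hn : 0 < n) {t : ℝ} (ht : t = 1 / (2 * (n : ℝ) + 1)) :
    2 * (t + t ^ 3 / 3) ≤ Real.log ((n : ℝ) + 1) - Real.log n ∧
      Real.log ((n : ℝ) + 1) - Real.log n ≤ 2 * (t + t ^ 3 / 3) + 2 * t ^ 5 / (1 - t ^ 2) := by
  have hn' : (1 : ℝ) ≤ n := by exact_mod_cast hn
  have ht0 : 0 < t := by rw [ht]; positivity
  have ht1 : t < 1 := by rw [ht, div_lt_one (by positivity)]; linarith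
  have ht2 : t ^ 2 < 1 := by nlinarith
  have h := Real.hasSum_log_sub_log_of_abs_lt_one (x := t) (by rwa [abs_of_pos ht0])
  have hlog : Real.log (1 + t) - Real.log (1 - t) = Real.log ((n : ℝ) + 1) - Real.log n := by
    rw [← Real.log_div (by linarith) (by linarith), ← Real.log_div (by linarith) (by linarith)]
    congr 1
    rw [ht]
    field_simp
    ring
  rw [hlog] at h
  have h2 := (hasSum_nat_add_iff' 2).2 h
  simp only [Finset.sum_range_succ, Finset.sum_range_zero] at h2
  have hg := ((hasSum_geometric_of_lt_one (sq_nonneg t) ht2).mul_left (2 * t ^ 5))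
  constructor
  · have := hasSum_mono (hasSum_zero) h2 (fun k => by positivity)
    norm_num at this
    linarith
  · have := hasSum_mono h2 hg (fun k => by
      have h1 : (1 : ℝ) / (2 * ((k + 2 : ℕ) : ℝ) + 1) ≤ 1 := by
        rw [div_le_one (by positivity)]; push_cast; nlinarith [(Nat.cast_nonneg k : (0:ℝ) ≤ k)]
      have h3 : t ^ (2 * (k + 2) + 1) = t ^ 5 * (t ^ 2) ^ k := by ring
      have h4 : 0 ≤ 2 * (t ^ 5 * (t ^ 2) ^ k) := by positivity
      change (2 : ℝ) * (1 / (2 * ((k + 2 : ℕ) : ℝ) + 1)) * t ^ (2 * (k + 2) + 1) ≤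
        2 * t ^ 5 * (t ^ 2) ^ k
      rw [h3]
      nlinarith)
    norm_num at this
    have h5 : 2 * t ^ 5 / (1 - t ^ 2) = 2 * t ^ 5 * (1 - t ^ 2)⁻¹ := div_eq_mul_inv _ _
    linarith

theorem trapezoidError_bounds {k : ℕ} (hk : 0 < k) :
    0 ≤ trapezoidError k ∧ trapezoidError k ≤ 1 / (k : ℝ) ^ 3 := by
  have hk' : (1 : ℝ) ≤ k := by exact_mod_cast hk
  obtain ⟨h1, h2⟩ := log_succ_sub_log_bounds hk rfl
  set t : ℝ := 1 / (2 * (k : ℝ) + 1) with ht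
  have ht0 : 0 < t := by positivity
  have ht1 : t < 1 := by rw [ht, div_lt_one (by positivity)]; linarith
  have ht2 : t ^ 2 < 1 := by nlinarith
  have hmain : (1 / (k : ℝ) + 1 / ((k : ℝ) + 1)) / 2 = 2 * t / (1 - t ^ 2) := by
    have : 1 - t ^ 2 = 4 * k * (k + 1) / (2 * k + 1) ^ 2 := by rw [ht]; field_simp; ring
    rw [this, ht]; field_simp; ring
  have hsub : 2 * t / (1 - t ^ 2) = 2 * (t + t ^ 3) + 2 * t ^ 5 / (1 - t ^ 2) := by
    have : 1 - t ^ 2 ≠ 0 := by linarith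
    field_simp; ring
  have hcube : 0 ≤ t ^ 3 := by positivity
  constructor
  · rw [trapezoidError, hmain, hsub]
    linarith
  · have h3 : (1 / (k : ℝ) + 1 / ((k : ℝ) + 1)) / 2 - 2 * t = 1 / (2 * k * (k + 1) * (2 * k + 1)) := by
      rw [ht]; field_simp; ring
    have h4 : 1 / (2 * (k : ℝ) * (k + 1) * (2 * k + 1)) ≤ 1 / (k : ℝ) ^ 3 := by
      apply one_div_le_one_div_of_le (by positivity)
      have : (0 : ℝ) ≤ k ^ 3 := by positivity
      nlinarith [sq_nonneg (k : ℝ)]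
    rw [trapezoidError]
    linarith

/-! ### Base-`B` blocks -/

theorem hasSum_mul_sum_block {B : ℕ} (hB : 0 < B) {c F : ℕ → ℝ} {S : ℝ}
    (h : HasSum (fun n => c (n / B) * F n) S) :
    HasSum (fun k => c k * ∑ j ∈ Finset.range B, F (B * k + j)) S := by
  have : NeZero B := ⟨hB.ne'⟩
  have h1 := (Nat.divModEquiv B).symm.hasSum_iff.2 h
  have h2 := h1.prod_fiberwise (fun k => hasSum_fintype _)
  convert h2 using 2 with k
  rw [Finset.mul_sum, ← Fin.sum_univ_eq_sum_range (fun j => c k * F (B * k + j))]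
  refine Finset.sum_congr rfl fun j _ => ?_
  have : (Nat.divModEquiv B).symm (k, j) = B * k + j := by
    simp [Nat.divModEquiv, mul_comm]
  simp only [Function.comp, this]
  rw [Nat.mul_add_div hB, Nat.div_eq_of_lt j.2, add_zero]

theorem sum_range_log_block {B k : ℕ} (n : ℕ) :
    ∑ j ∈ Finset.range n, (Real.log (((B * k + j : ℕ) : ℝ) + 1) - Real.log ((B * k + j : ℕ) : ℝ)) =
      Real.log ((B * k + n : ℕ) : ℝ) - Real.log ((B * k : ℕ) : ℝ) := by
  have := Finset.sum_range_sub (fun j => Real.log ((B * k + j : ℕ) : ℝ)) n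
  simpa [add_assoc] using this

theorem addisonP_div_eq {B k : ℕ} (hB : 1 < B) (hk : 0 < k) :
    addisonP B k / ∏ j ∈ Finset.range (B + 1), ((B : ℝ) * k + j) =
      trapezoidError k - ∑ j ∈ Finset.range B, trapezoidError (B * k + j) := by
  have hB' : (1 : ℝ) < B := by exact_mod_cast hB
  have hk' : (1 : ℝ) ≤ k := by exact_mod_cast hk
  have hBk : 0 < (B : ℝ) * k := by positivity
  have hrec : ∑ j ∈ Finset.range B, trapezoidError (B * k + j) =
      (1 / ((B : ℝ) * k) + 1 / ((B : ℝ) * k + B)) / 2 +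
        ∑ m ∈ Finset.Ico 1 B, 1 / ((B : ℝ) * k + m) - (Real.log ((k : ℝ) + 1) - Real.log k) := by
    have hlog : Real.log ((B * k + B : ℕ) : ℝ) - Real.log ((B * k : ℕ) : ℝ) =
        Real.log ((k : ℝ) + 1) - Real.log k := by
      push_cast
      rw [show (B : ℝ) * k + B = B * (k + 1) by ring, Real.log_mul (by positivity) (by positivity),
        Real.log_mul (by positivity) (by positivity)]
      ring
    simp only [trapezoidError]
    rw [Finset.sum_sub_distrib, sum_range_log_block, hlog, ← Finset.sum_div,
      Finset.sum_add_distrib]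
    congr 1
    have h1 : ∑ j ∈ Finset.range B, 1 / ((B * k + j : ℕ) : ℝ) =
        1 / ((B : ℝ) * k) + ∑ m ∈ Finset.Ico 1 B, 1 / ((B : ℝ) * k + m) := by
      rw [Finset.range_eq_Ico, Finset.sum_eq_sum_Ico_succ_bot (by omega)]
      simp
    have h2 : ∑ j ∈ Finset.range B, 1 / (((B * k + j : ℕ) : ℝ) + 1) =
        ∑ m ∈ Finset.Ico 1 B, 1 / ((B : ℝ) * k + m) + 1 / ((B : ℝ) * k + B) := by
      have := Finset.sum_Ico_succ_top (show 1 ≤ B by omega) (fun m : ℕ => 1 / ((B : ℝ) * k + m))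
      rw [← this, Finset.sum_Ico_eq_sum_range]
      refine Finset.sum_congr rfl fun j _ => ?_
      push_cast; ring
    rw [h1, h2]; ring
  have hprod : ∏ j ∈ Finset.range (B + 1), ((B : ℝ) * k + j) =
      (B : ℝ) * k * (∏ j ∈ Finset.Ico 1 B, ((B : ℝ) * k + j)) * ((B : ℝ) * k + B) := by
    rw [Finset.prod_range_succ, Finset.range_eq_Ico, Finset.prod_eq_prod_Ico_succ_bot (by omega)]
    simp
  have hne : ∏ j ∈ Finset.Ico 1 B, ((B : ℝ) * k + j) ≠ 0 :=
    (Finset.prod_pos fun j _ => by positivity).ne'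
  have hgauss : ∑ m ∈ Finset.Ico 1 B, ((B : ℝ) - m) = ∑ m ∈ Finset.Ico 1 B, (m : ℝ) := by
    have h := Finset.sum_Ico_reflect (fun m : ℕ => (m : ℝ)) 1 (show B ≤ B + 1 by omega)
    rw [show B + 1 - B = 1 by omega, show B + 1 - 1 = B by omega] at h
    rw [← h]
    refine Finset.sum_congr rfl fun j hj => ?_
    rw [Nat.cast_sub (Finset.mem_Ico.1 hj).2.le]
  have hcard : ∑ m ∈ Finset.Ico 1 B, (B : ℝ) = (B - 1) * B := by
    rw [Finset.sum_const, Nat.card_Ico, nsmul_eq_mul, Nat.cast_sub hB.le, Nat.cast_one]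
  have hsum : ∑ m ∈ Finset.Ico 1 B, (m : ℝ) = (B - 1) * B / 2 := by
    have := hgauss
    rw [Finset.sum_sub_distrib, hcard] at this
    linarith
  -- Termwise, the error at `Bk+m` of interpolating `1/x` linearly between `Bk` and `Bk+B`.
  have hpf : (∑ m ∈ Finset.Ico 1 B, (m : ℝ) * ((B : ℝ) - m) / ((B : ℝ) * k + m)) /
      ((B : ℝ) * k * ((B : ℝ) * k + B)) =
      (∑ m ∈ Finset.Ico 1 B, ((B : ℝ) - m)) / (B * (B * k)) +
      (∑ m ∈ Finset.Ico 1 B, (m : ℝ)) / (B * (B * k + B)) -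
        ∑ m ∈ Finset.Ico 1 B, 1 / ((B : ℝ) * k + m) := by
    rw [Finset.sum_div, Finset.sum_div, Finset.sum_div, ← Finset.sum_add_distrib,
      ← Finset.sum_sub_distrib]
    refine Finset.sum_congr rfl fun m _ => ?_
    have : (0 : ℝ) < (B : ℝ) * k + m := by positivity
    field_simp
    ring
  rw [hrec, hprod, addisonP, trapezoidError]
  have : ∀ x s a b : ℝ, x ≠ 0 → x * s / (a * x * b) = s / (a * b) := fun x s a b hx => by
    rw [show a * x * b = x * (a * b) by ring, mul_div_mul_left _ _ hx]
  rw [this _ _ _ _ hne, hpf, hgauss, hsum]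
  field_simp
  ring

/-! ### Existence and positivity of the Glaisher–Kinkelin constant -/

/-- The logarithm `∑ j ≤ n, j log j` of the hyperfactorial. -/
noncomputable def logHyperfactorial (n : ℕ) : ℝ :=
  ∑ j ∈ Finset.range n, ((j : ℝ) + 1) * Real.log ((j : ℝ) + 1)

theorem log_prod_pow_self (n : ℕ) :
    Real.log (∏ j ∈ Finset.Icc 1 n, (j : ℝ) ^ j) = logHyperfactorial n := by
  induction n with
  | zero => simp [logHyperfactorial]
  | succ n ih =>
    have h : ∏ j ∈ Finset.Icc 1 n, (j : ℝ) ^ j ≠ 0 := by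
      refine (Finset.prod_pos fun j hj => ?_).ne'
      have : 0 < j := (Finset.mem_Icc.1 hj).1
      positivity
    rw [Finset.prod_Icc_succ_top (by omega), Real.log_mul h (by positivity), ih, Real.log_pow,
      logHyperfactorial, logHyperfactorial, Finset.sum_range_succ]
    push_cast; ring

/-- The logarithm of `glaisherSeq`, at positive integers. -/
noncomputable def logGlaisherSeq (n : ℕ) : ℝ :=
  logHyperfactorial n - (((n : ℝ) ^ 2 + n) / 2 + 1 / 12) * Real.log n + (n : ℝ) ^ 2 / 4

theorem glaisherSeq_eq_exp {n : ℕ} (hn : 0 < n) : glaisherSeq n = Real.exp (logGlaisherSeq n) := by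
  have hn' : (0 : ℝ) < n := by exact_mod_cast hn
  have h : 0 < ∏ j ∈ Finset.Icc 1 n, (j : ℝ) ^ j := by
    refine Finset.prod_pos fun j hj => ?_
    have : 0 < j := (Finset.mem_Icc.1 hj).1
    positivity
  rw [glaisherSeq, logGlaisherSeq, ← log_prod_pow_self, Real.exp_add, Real.exp_sub,
    Real.exp_log h, Real.rpow_def_of_pos hn', Real.exp_neg, mul_comm (Real.log _)]
  field_simp

theorem abs_logGlaisherSeq_succ_sub_le {n : ℕ} (hn : 0 < n) :
    |logGlaisherSeq (n + 1) - logGlaisherSeq n| ≤ 1 / (n : ℝ) ^ 3 := by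
  have hn' : (1 : ℝ) ≤ n := by exact_mod_cast hn
  obtain ⟨h1, h2⟩ := log_succ_sub_log_bounds hn rfl
  set t : ℝ := 1 / (2 * (n : ℝ) + 1) with ht
  have ht0 : 0 < t := by positivity
  have htn : t ≤ 1 / n := by
    rw [ht]; exact one_div_le_one_div_of_le (by positivity) (by linarith)
  have ht3 : t ≤ 1 / 3 := by
    rw [ht]; exact one_div_le_one_div_of_le (by positivity) (by linarith)
  have ht2 : t ^ 2 ≤ 1 / 9 := by nlinarith
  set l := Real.log ((n : ℝ) + 1) - Real.log n with hl
  have hdiff : logGlaisherSeq (n + 1) - logGlaisherSeq n =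
      1 / (4 * t) - (1 / t ^ 2 - 1 / 3) / 8 * l := by
    have hi : 1 / t = 2 * n + 1 := by rw [ht, one_div_one_div]
    have hi4 : 1 / (4 * t) = (2 * n + 1) / 4 := by rw [← hi]; field_simp
    have hi2 : 1 / t ^ 2 = (2 * n + 1) ^ 2 := by rw [← hi]; field_simp
    rw [hi4, hi2, hl, logGlaisherSeq, logGlaisherSeq, logHyperfactorial, Finset.sum_range_succ,
      ← logHyperfactorial]
    push_cast; ring
  have hcoef : 0 ≤ (1 / t ^ 2 - 1 / 3) / 8 := by
    have : 9 ≤ 1 / t ^ 2 := by rw [le_div_iff₀ (by positivity)]; linarith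
    linarith
  have hm1 := mul_le_mul_of_nonneg_left h1 hcoef
  have hm2 := mul_le_mul_of_nonneg_left h2 hcoef
  -- The exponent `1/12` makes the terms in `t` cancel, so the increments are `O(n⁻³)`, hence
  -- summable.
  have he1 : (1 / t ^ 2 - 1 / 3) / 8 * (2 * (t + t ^ 3 / 3)) = 1 / (4 * t) - t ^ 3 / 36 := by
    field_simp; ring
  have he2 : (1 / t ^ 2 - 1 / 3) / 8 * (2 * t ^ 5 / (1 - t ^ 2)) ≤ t ^ 3 := by
    have h9 : 0 < 1 - t ^ 2 := by linarith
    have : (1 / t ^ 2 - 1 / 3) / 8 * (2 * t ^ 5 / (1 - t ^ 2)) =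
        t ^ 3 * ((1 - t ^ 2 / 3) / (4 * (1 - t ^ 2))) := by
      field_simp
      ring
    rw [this]
    refine mul_le_of_le_one_right (by positivity) ?_
    rw [div_le_one (by positivity)]
    nlinarith
  have hc : t ^ 3 ≤ 1 / (n : ℝ) ^ 3 := by
    rw [← one_div_pow]; exact pow_le_pow_left₀ ht0.le htn 3
  have hc0 : 0 < t ^ 3 := by positivity
  rw [mul_add] at hm2
  rw [hdiff, abs_le]
  constructor <;> linarith

theorem exists_tendsto_logGlaisherSeq : ∃ a, Tendsto logGlaisherSeq atTop (𝓝 a) := by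
  refine cauchySeq_tendsto_of_complete (cauchySeq_of_summable_dist ?_)
  rw [← summable_nat_add_iff 1]
  refine Summable.of_nonneg_of_le (fun _ => dist_nonneg) (fun n => ?_)
    ((summable_nat_add_iff 1).2 (Real.summable_one_div_nat_pow.2 (by norm_num : 1 < 3)))
  rw [dist_comm, Real.dist_eq]
  exact abs_logGlaisherSeq_succ_sub_le n.succ_pos

theorem glaisherConst_spec : Tendsto glaisherSeq atTop (𝓝 glaisherConst) ∧ 0 < glaisherConst ∧
    Tendsto logGlaisherSeq atTop (𝓝 (Real.log glaisherConst)) := by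
  obtain ⟨a, ha⟩ := exists_tendsto_logGlaisherSeq
  have h : Tendsto glaisherSeq atTop (𝓝 (Real.exp a)) := by
    refine ((Real.continuous_exp.tendsto a).comp ha).congr' ?_
    filter_upwards [eventually_gt_atTop 0] with n hn using (glaisherSeq_eq_exp hn).symm
  have hA : glaisherConst = Real.exp a := h.limUnder_eq
  rw [hA, Real.log_exp]
  exact ⟨h, Real.exp_pos a, ha⟩

/-! ### The alternating sum -/

theorem sum_alternating_trapezoidError (M : ℕ) :
    ∑ k ∈ Finset.range (2 * M),
      (-1) ^ k * (6 * ((k : ℝ) + 1) + 3) * trapezoidError (k + 1) =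
      3 / 2 * (2 * ((harmonic (2 * M) : ℝ) - harmonic M) - 1 + 1 / (2 * M + 1)) -
      3 * (4 * (4 * logHyperfactorial M + 2 * M * (M + 1) * Real.log 2 -
        logHyperfactorial (2 * M)) - (4 * M + 1) * Real.log (2 * M + 1)) := by
  induction M with
  | zero => simp [logHyperfactorial]
  | succ M ih =>
    have hlog : Real.log (2 * (M : ℝ) + 2) = Real.log 2 + Real.log ((M : ℝ) + 1) := by
      rw [← Real.log_mul (by norm_num) (by positivity)]; ring_nf
    rw [show 2 * (M + 1) = 2 * M + 1 + 1 by ring, Finset.sum_range_succ, Finset.sum_range_succ, ih]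
    simp only [harmonic_succ, logHyperfactorial, Finset.sum_range_succ, trapezoidError]
    push_cast
    rw [pow_succ, pow_mul]
    norm_num only
    rw [one_pow, show (2 : ℝ) * M + 1 + 1 = 2 * M + 2 by ring,
      show (2 : ℝ) * (M + 1) + 1 = 2 * M + 2 + 1 by ring, hlog]
    have h1 : (2 : ℝ) * M + 1 ≠ 0 := by positivity
    have h2 : (M : ℝ) + 1 ≠ 0 := by positivity
    have h3 : (2 : ℝ) * M + 2 + 1 ≠ 0 := by positivity
    have h4 : (2 : ℝ) * M + 2 ≠ 0 := by positivity
    field_simp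
    ring

theorem tendsto_harmonic_two_mul_sub :
    Tendsto (fun n : ℕ => (harmonic (2 * n) : ℝ) - harmonic n) atTop (𝓝 (Real.log 2)) := by
  have h2 : Tendsto (fun n : ℕ => 2 * n) atTop atTop :=
    tendsto_id.const_mul_atTop' (by norm_num)
  have h := ((Real.tendsto_harmonic_sub_log.comp h2).sub Real.tendsto_harmonic_sub_log).add
    (tendsto_const_nhds (x := Real.log 2))
  rw [sub_self, zero_add] at h
  refine h.congr' ?_
  filter_upwards [eventually_gt_atTop 0] with n hn
  have hn' : (0 : ℝ) < n := by exact_mod_cast hn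
  simp only [Function.comp]
  push_cast
  rw [Real.log_mul (by norm_num) hn'.ne']
  ring

theorem tendsto_mul_log_succ_sub_log :
    Tendsto (fun m : ℕ => (2 * (m : ℝ) + 1) * (Real.log ((m : ℝ) + 1) - Real.log m))
      atTop (𝓝 2) := by
  have h1 : Tendsto (fun m : ℕ => (1 : ℝ) / m) atTop (𝓝 0) := tendsto_one_div_atTop_nhds_zero_nat
  have h := Real.tendsto_mul_log_one_add_div_atTop 1
  have h' := h.comp (tendsto_natCast_atTop_atTop (R := ℝ))
  have hz := (h1.const_add 2).mul h'
  rw [add_zero, mul_one] at hz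
  refine hz.congr' ?_
  filter_upwards [eventually_gt_atTop 0] with n hn
  have hn' : (0 : ℝ) < n := by exact_mod_cast hn
  simp only [Function.comp]
  rw [← Real.log_div (by positivity) hn'.ne', show ((n : ℝ) + 1) / n = 1 + 1 / n by field_simp]
  field_simp

theorem tendsto_sum_alternating_trapezoidError :
    Tendsto (fun M : ℕ => ∑ k ∈ Finset.range (2 * M),
      (-1) ^ k * (6 * ((k : ℝ) + 1) + 3) * trapezoidError (k + 1)) atTop
      (𝓝 (7 * Real.log 2 + 9 / 2 - 36 * Real.log glaisherConst)) := by
  have hA := glaisherConst_spec.2.2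
  have h2 : Tendsto (fun n : ℕ => 2 * n) atTop atTop :=
    tendsto_id.const_mul_atTop' (by norm_num)
  have h1 : Tendsto (fun m : ℕ => (1 : ℝ) / (2 * m + 1)) atTop (𝓝 0) :=
    ((tendsto_one_div_add_atTop_nhds_zero_nat (𝕜 := ℝ)).comp h2).congr fun m => by
      simp
  -- In `4 log H(M) - log H(2M)`, with `H` the hyperfactorial, the quadratic terms cancel; the limit
  -- `4 log A - log A`, times 12, gives `36 log A`.
  have h := (((((tendsto_harmonic_two_mul_sub.const_mul 2).sub_const 1).add h1).const_mul
    (3 / 2)).sub ((((hA.const_mul 4).sub (hA.comp h2)).const_mul 12).sub_const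
      (4 * Real.log 2))).add ((tendsto_mul_log_succ_sub_log.comp h2).const_mul 3)
  convert h.congr' ?_ using 2
  · ring
  · filter_upwards [eventually_gt_atTop 0] with M hM
    have hM' : (0 : ℝ) < M := by exact_mod_cast hM
    rw [sum_alternating_trapezoidError]
    simp only [Function.comp, logGlaisherSeq]
    push_cast
    rw [Real.log_mul (by norm_num) hM'.ne']
    ring

/-! ### The coefficients -/

/-- The coefficient `7 L_B(k) - 7 L_B(⌊k / 2⌋) + b_k` of the series. -/
noncomputable def seriesCoeff (B k : ℕ) : ℝ :=
  7 * (baseLength B k : ℝ) - 7 * (baseLength B (k / 2) : ℝ) + (glaisherCoeff B k : ℝ)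

theorem baseLength_of_pos {B k : ℕ} (hB : 1 < B) (hk : 0 < k) :
    baseLength B k = baseLength B (k / B) + 1 := by
  rw [baseLength, Nat.digits_def' hB hk, List.length_cons, baseLength]

theorem baseLength_le {B : ℕ} (hB : 1 < B) (k : ℕ) : baseLength B k ≤ k := by
  induction k using Nat.strong_induction_on with
  | _ k ih =>
    rcases Nat.eq_zero_or_pos k with rfl | hk
    · simp [baseLength]
    · have h := Nat.div_lt_self hk hB
      have := ih _ h
      rw [baseLength_of_pos hB hk]
      omega

/-- The constant 18 closes the induction: `18 (k/2) + (6k+3) ≤ 18k` for `k ≥ 1`. -/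
theorem abs_glaisherCoeff_le {B : ℕ} (hB : 1 < B) (k : ℕ) :
    |(glaisherCoeff B k : ℝ)| ≤ 18 * k := by
  induction k using Nat.strong_induction_on with
  | _ k ih =>
    rcases Nat.eq_zero_or_pos k with rfl | hk
    · simp [glaisherCoeff_zero]
    · have h := ih _ (Nat.div_lt_self hk hB)
      have h2 : ((k / B : ℕ) : ℝ) ≤ k / 2 :=
        Nat.cast_div_le.trans (div_le_div_of_nonneg_left (by positivity) (by norm_num)
          (by exact_mod_cast hB))
      have hk' : (1 : ℝ) ≤ k := by exact_mod_cast hk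
      rw [glaisherCoeff_of_pos hB hk]
      push_cast
      refine (abs_add_le _ _).trans ?_
      rw [abs_mul, abs_pow, abs_neg, abs_one, one_pow, one_mul,
        abs_of_nonneg (by positivity : (0 : ℝ) ≤ 6 * k + 3)]
      linarith

theorem abs_seriesCoeff_le {B : ℕ} (hB : 1 < B) (k : ℕ) : |seriesCoeff B k| ≤ 32 * k := by
  have h1 : (baseLength B k : ℝ) ≤ k := by exact_mod_cast baseLength_le hB k
  have h2 : (baseLength B (k / 2) : ℝ) ≤ k := by
    exact_mod_cast (baseLength_le hB _).trans (Nat.div_le_self _ _)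
  have h3 := abs_le.1 (abs_glaisherCoeff_le hB k)
  have h4 : (0 : ℝ) ≤ baseLength B k := by positivity
  have h5 : (0 : ℝ) ≤ baseLength B (k / 2) := by positivity
  rw [seriesCoeff, abs_le]
  constructor <;> linarith [h3.1, h3.2]

/-- Dropping a digit lowers both lengths by one, unless the index is 1, whose half is 0; only there
does a 7 survive. -/
theorem seriesCoeff_sub_succ {B : ℕ} (hB : 1 < B) (k : ℕ) :
    seriesCoeff B (k + 1) - seriesCoeff B ((k + 1) / B) =
      (if k = 0 then 7 else 0) + (-1) ^ k * (6 * ((k : ℝ) + 1) + 3) := by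
  have h1 := baseLength_of_pos hB (show 0 < k + 1 by omega)
  have h3 := glaisherCoeff_of_pos hB (show 1 ≤ k + 1 by omega)
  rw [seriesCoeff, seriesCoeff, h3, h1]
  rcases Nat.eq_zero_or_pos k with rfl | hk
  · simp [Nat.div_eq_of_lt hB, baseLength_zero]
    ring
  · have h2 := baseLength_of_pos hB (show 0 < (k + 1) / 2 by omega)
    rw [h2, Nat.div_div_eq_div_mul, Nat.div_div_eq_div_mul, mul_comm 2 B, if_neg hk.ne']
    push_cast
    ring

/-! ### Summation of the series -/

theorem glaisherTerm_eq {B : ℕ} (hB : 1 < B) (k : ℕ) :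
    glaisherTerm B k =
      seriesCoeff B k * trapezoidError k -
        seriesCoeff B k * ∑ j ∈ Finset.range B, trapezoidError (B * k + j) := by
  rcases Nat.eq_zero_or_pos k with rfl | hk
  · simp [glaisherTerm, seriesCoeff, baseLength_zero, glaisherCoeff_zero]
  · rw [glaisherTerm, addisonP_div_eq hB hk, ← seriesCoeff, mul_sub]

theorem summable_mul_trapezoidError {c : ℕ → ℝ} {C : ℝ} (hc : ∀ k, |c k| ≤ C * k) :
    Summable fun k => c k * trapezoidError k := by
  refine Summable.of_norm_bounded
    ((Real.summable_one_div_nat_pow.2 (by norm_num : 1 < 2)).mul_left C) fun k => ?_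
  rcases Nat.eq_zero_or_pos k with rfl | hk
  · have : c 0 = 0 := by simpa using hc 0
    simp [this]
  · obtain ⟨h0, h1⟩ := trapezoidError_bounds hk
    have hk' : (0 : ℝ) < k := by exact_mod_cast hk
    rw [Real.norm_eq_abs, abs_mul, abs_of_nonneg h0]
    refine (mul_le_mul (hc k) h1 h0 ((abs_nonneg _).trans (hc k))).trans_eq ?_
    field_simp

theorem hasSum_glaisherTerm {B : ℕ} (hB : 1 < B) :
    HasSum (glaisherTerm B) (39 / 4 - 36 * Real.log glaisherConst) := by
  have hs1 := summable_mul_trapezoidError (abs_seriesCoeff_le hB)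
  have hs2 := summable_mul_trapezoidError (c := fun k => seriesCoeff B (k / B)) (C := 32)
    fun k => (abs_seriesCoeff_le hB _).trans (by
      have : ((k / B : ℕ) : ℝ) ≤ k := by exact_mod_cast Nat.div_le_self _ _
      linarith)
  have h := hs1.hasSum.sub (hasSum_mul_sum_block (by omega) hs2.hasSum)
  simp only [← glaisherTerm_eq hB] at h
  have hd := (hasSum_nat_add_iff' 1).2 (hs1.hasSum.sub hs2.hasSum)
  -- This discards index 0, where `trapezoidError` takes a junk value.
  have h0 : seriesCoeff B 0 = 0 := by simpa using abs_seriesCoeff_le hB 0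
  simp only [Finset.sum_range_one, Nat.zero_div, h0, zero_mul, sub_self, sub_zero, ← sub_mul,
    seriesCoeff_sub_succ hB] at hd
  have h2 : Tendsto (fun n : ℕ => 2 * n) atTop atTop :=
    tendsto_id.const_mul_atTop' (by norm_num)
  have hlim := tendsto_sum_alternating_trapezoidError.const_add (7 * trapezoidError 1)
  have hone : trapezoidError 1 = 3 / 4 - Real.log 2 := by
    norm_num [trapezoidError]
  have huniq := tendsto_nhds_unique (hd.tendsto_sum_nat.comp h2) (hlim.congr' (by
    filter_upwards [eventually_gt_atTop 0] with M hM
    simp only [Function.comp, add_mul, Finset.sum_add_distrib, ite_mul, zero_mul]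
    rw [Finset.sum_ite_eq' (Finset.range (2 * M)) 0, if_pos (by simp [hM])]))
  rw [huniq, hone] at h
  rwa [show 7 * (3 / 4 - Real.log 2) + (7 * Real.log 2 + 9 / 2 - 36 * Real.log glaisherConst) =
    39 / 4 - 36 * Real.log glaisherConst by ring] at h

theorem corollary12 (B : ℕ) (hB : 1 < B) :
    Tendsto glaisherSeq atTop (𝓝 glaisherConst) ∧ 0 < glaisherConst ∧
      Summable (fun k : ℕ => glaisherTerm B (k + 1)) ∧
      Real.log glaisherConst = 13 / 48 - (1 / 36) * ∑' k : ℕ, glaisherTerm B (k + 1) := by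
  have h := (hasSum_nat_add_iff' 1).2 (hasSum_glaisherTerm hB)
  have h0 : glaisherTerm B 0 = 0 := by
    simp [glaisherTerm, baseLength_zero, glaisherCoeff_zero]
  rw [Finset.sum_range_one, h0, sub_zero] at h
  refine ⟨glaisherConst_spec.1, glaisherConst_spec.2.1, h.summable, ?_⟩
  rw [h.tsum_eq]
  ring
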